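/- For real $C$ and an integer $n\ge 1$ write $$\begin{aligned} A(C,n)={}&\frac{1}{n^{1/2}}+\frac{3}{10}\frac{\ln n}{n^{3/2}}+\frac{C}{2}\frac{1}{n^{3/2}} +\frac{27}{200}\frac{(\ln n)^2}{n^{5/2}}+\Bigl(\frac{9}{20}C-\frac{9}{50}\Bigr)\frac{\ln n}{n^{5/2}} +\Bigl(\frac38C^2-\frac{3}{10}C+\frac{79}{700}\Bigr)\frac1{n^{5/2}}\\ &+\frac{27}{400}\frac{(\ln n)^3}{n^{7/2}}+\Bigl(\frac{27}{80}C-\frac{27}{125}\Bigr)\frac{(\ln n)^2}{n^{7/2}} +\Bigl(\frac9{16}C^2-\frac{18}{25}C+\frac{1941}{7000}\Bigr)\frac{\ln n}{n^{7/2}} +\Bigl(\frac5{16}C^3-\frac35C^2+\frac{647}{1400}C-\frac{411}{3500}\Bigr)\frac1{n^{7/2}}\\ &+\frac{567}{16000}\frac{(\ln n)^4}{n^{9/2}}+\Bigl(\frac{189}{800}C-\frac{1917}{10000}\Bigr)\frac{(\ln n)^3}{n^{9/2}} +\Bigl(\frac{189}{320}C^2-\frac{1917}{2000}C+\frac{1683}{4000}\Bigr)\frac{(\ln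 n)^2}{n^{9/2}}\\ &+\Bigl(\frac{21}{32}C^3-\frac{639}{400}C^2+\frac{561}{400}C-\frac{7227}{17500}\Bigr)\frac{\ln n}{n^{9/2}} +\Bigl(\frac{35}{128}C^4-\frac{71}{80}C^3+\frac{187}{160}C^2-\frac{2409}{3500}C+\frac{1606257}{10780000}\Bigr)\frac1{n^{9/2}}, \end{aligned}$$ and let $a_{m,k}(C)$, $0\le k\le m\le 4$, be the coefficient displayed here in front of $(\ln n)^k/n^{m+1/2}$, so that $A(C,n)=\sum_{m=0}^{4}\sum_{k=0}^{m}a_{m,k}(C)\,(\ln n)^k\,n^{-m-1/2}$. 1. (Inverse hyperbolic sine.) Let $x_0>0$ and $x_n=\operatorname{arcsinh}(x_{n-1})$ for $n\ge1$. There is a unique constant $C=C(x_0)$ such that $$\frac{x_n}{\sqrt3}=A(C,n)+o\bigl(n^{-9/2}\bigr)\qquad(n\to\infty).$$ 2. (Polynomial form.) With $P_1=X$, $P_2=\frac32X^2-\frac35X+\frac{79}{700}$, $P_3=\frac52X^3-\frac{12}5X^2+\frac{647}{700}X-\frac{411}{3500}$, $P_4=\frac{35}8X^4-\frac{71}{10}X^3+\frac{187}{40}X^2-\frac{2409}{1750}X+\frac{1606257}{10780000}$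 one has, for all real $C$ and all $n\ge1$, $$\sqrt3\,A(C,n)=\Bigl(\frac3n\Bigr)^{1/2}\Bigl\{1+\sum_{m=1}^{4}P_m\Bigl(-\frac12\Bigl[-\frac35\ln n-C\Bigr]\Bigr)\frac1{n^m}\Bigr\}.$$ 3. (Sine.) Let $0<x_0<\pi$ and $x_n=\sin(x_{n-1})$ for $n\ge1$. There is a unique constant $C=C(x_0)$ (its own constant, unrelated to the one in 1) such that $$\frac{x_n}{\sqrt3}=\sum_{m=0}^{4}\sum_{k=0}^{m}s_{m,k}(C)\,\frac{(\ln n)^k}{n^{m+1/2}}+o\bigl(n^{-9/2}\bigr)\qquad(n\to\infty),$$ where $s_{m,k}(C)=a_{m,k}(C)$ for $m=0,2,4$ and $s_{m,k}(C)=-a_{m,k}(C)$ for $m=1,3$. 4. Consequently the two expansions agree term by term up to sign: $s_{m,k}(C)=(-1)^m a_{m,k}(C)$, and in particular $|s_{m,k}(C)|=|a_{m,k}(C)|$, for all $0\le k\le m\le4$ and all real $C$. -/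

import Mathlib

open Filter Asymptotics

noncomputable section

/-- Coefficient of `(log n) ^ k / n ^ (m + 1/2)`, for `0 ≤ k ≤ m ≤ 4`, in the expansion of
`x n / √3` for the iteration of `arsinh`; it depends on the constant `C`. -/
def arsinhCoeff : ℕ → ℕ → ℝ → ℝ
  | 0, 0, _ => 1
  | 1, 1, _ => 3 / 10
  | 1, 0, C => C / 2
  | 2, 2, _ => 27 / 200
  | 2, 1, C => 9 / 20 * C - 9 / 50
  | 2, 0, C => 3 / 8 * C ^ 2 - 3 / 10 * C + 79 / 700
  | 3, 3, _ => 27 / 400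
  | 3, 2, C => 27 / 80 * C - 27 / 125
  | 3, 1, C => 9 / 16 * C ^ 2 - 18 / 25 * C + 1941 / 7000
  | 3, 0, C => 5 / 16 * C ^ 3 - 3 / 5 * C ^ 2 + 647 / 1400 * C - 411 / 3500
  | 4, 4, _ => 567 / 16000
  | 4, 3, C => 189 / 800 * C - 1917 / 10000
  | 4, 2, C => 189 / 320 * C ^ 2 - 1917 / 2000 * C + 1683 / 4000
  | 4, 1, C => 21 / 32 * C ^ 3 - 639 / 400 * C ^ 2 + 561 / 400 * C - 7227 / 17500
  | 4, 0, C => 35 / 128 * C ^ 4 - 71 / 80 * C ^ 3 + 187 / 160 * C ^ 2 - 2409 / 3500 * C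
      + 1606257 / 10780000
  | _, _, _ => 0

/-- Coefficient of `(log n) ^ k / n ^ (m + 1/2)`, for `0 ≤ k ≤ m ≤ 4`, in the expansion of
`x n / √3` for the iteration of `sin`; it depends on the constant `C`. -/
def sinCoeff : ℕ → ℕ → ℝ → ℝ
  | 0, 0, _ => 1
  | 1, 1, _ => -(3 / 10)
  | 1, 0, C => -(C / 2)
  | 2, 2, _ => 27 / 200
  | 2, 1, C => 9 / 20 * C - 9 / 50
  | 2, 0, C => 3 / 8 * C ^ 2 - 3 / 10 * C + 79 / 700
  | 3, 3, _ => -(27 / 400)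
  | 3, 2, C => -(27 / 80 * C - 27 / 125)
  | 3, 1, C => -(9 / 16 * C ^ 2 - 18 / 25 * C + 1941 / 7000)
  | 3, 0, C => -(5 / 16 * C ^ 3 - 3 / 5 * C ^ 2 + 647 / 1400 * C - 411 / 3500)
  | 4, 4, _ => 567 / 16000
  | 4, 3, C => 189 / 800 * C - 1917 / 10000
  | 4, 2, C => 189 / 320 * C ^ 2 - 1917 / 2000 * C + 1683 / 4000
  | 4, 1, C => 21 / 32 * C ^ 3 - 639 / 400 * C ^ 2 + 561 / 400 * C - 7227 / 17500
  | 4, 0, C => 35 / 128 * C ^ 4 - 71 / 80 * C ^ 3 + 187 / 160 * C ^ 2 - 2409 / 3500 * C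
      + 1606257 / 10780000
  | _, _, _ => 0

/-- The expansion with the coefficient table `a`, constant `C`, up to order `n ^ (-9/2)`. -/
def iterExpansion (a : ℕ → ℕ → ℝ → ℝ) (C : ℝ) (n : ℕ) : ℝ :=
  ∑ m ∈ Finset.range 5, ∑ k ∈ Finset.range (m + 1),
    a m k C * Real.log n ^ k / (n : ℝ) ^ ((m : ℝ) + 1 / 2)

/-- The polynomials `P₀, …, P₄` of `arsinh`. -/
def arsinhP : ℕ → ℝ → ℝ
  | 0, _ => 1
  | 1, X => X
  | 2, X => 3 / 2 * X ^ 2 - 3 / 5 * X + 79 / 700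
  | 3, X => 5 / 2 * X ^ 3 - 12 / 5 * X ^ 2 + 647 / 700 * X - 411 / 3500
  | 4, X => 35 / 8 * X ^ 4 - 71 / 10 * X ^ 3 + 187 / 40 * X ^ 2 - 2409 / 1750 * X
      + 1606257 / 10780000
  | _, _ => 0

end

/-!
Both iterations become translations in the variable `w = 3 / x ^ 2`. Since
`(sinh x / x) ^ 2` is the series of `(sin x / x) ^ 2` in `y = x ^ 2` taken at `y = -x ^ 2`, one
computation treats both: a step changes `3 / y` into `3 / (y * S)`, where `S` is that series, and
`isBigO_stepDefect` shows that the truncated Abel function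
`z - 3/5 log |z| + 79/350 z⁻¹ + 87/875 z⁻² + 91543/1347500 z⁻³` of `z = 3 / y` grows by
`1 + O(y ^ 5)`. For `sin` one has `w = z`. For `arsinh` one has `w = -z` and the step is traversed
backwards; rewriting the Abel function in `w` changes the sign of every other coefficient, which
is the parameter `e = ±1` of `abelFn` and the source of the sign `(-1) ^ m` between the two
expansions.

The increments of `w` tend to `1`, so `w n ~ n`, and summing the errors gives
`abelFn e (w n) = n + K + o(n⁻³)` for a constant `K` (`exists_isLittleO_of_increment`). This
relation is inverted by verification. With `t = 1 / n` and `u = (3/10 log n + C/2) / n` the claimed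
expansion is `n ^ (-1/2) * (1 + s)`, where `s = iterSeries (e * u) (e * t)` is a polynomial in two
small quantities of size `O(log n / n)`. If `1 + v` is the inverse square of `1 + s` up to degree four,
then `n * (1 + v)` solves the Abel relation up to `o(n⁻³)` with `K = -e * C` (`abelFn_abelInv`). The
Abel function shrinks distances by a factor of at most two (`abs_sub_le_abelFn`), so `w n` agrees
with `n * (1 + v)` up to `o(n⁻³)`, and taking inverse square roots gives the expansion of
`x n / √3` up to `o(n ^ (-9/2))`. The constant is unique because it appears in the term of order `n ^ (-3/2)`.

The series manipulations are carried out with `GradedExpansion`, which stores the terms of an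
expansion as the coefficients of a power series, so that each of the identities reduces to finitely
many polynomial identities between coefficients.
-/

/-! ### Graded asymptotic expansions -/

/-- The first `n` terms of the Mercator series of `φ`, the formal counterpart of `log (1 + f)`. -/
noncomputable def PowerSeries.mercator (n : ℕ) (φ : PowerSeries ℝ) : PowerSeries ℝ :=
  ∑ j ∈ Finset.range n, PowerSeries.C ((-1) ^ j / (j + 1 : ℝ)) * φ ^ (j + 1)

/-- `f` has, along `l`, the expansion `∑ k < N, coeff k φ` up to `O(δ ^ N)`, where the term of
degree `k` is `O(δ ^ k)`. The terms are stored as the coefficients of a power series depending on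
the point, so that sums and products of expansions are sums and products of power series. -/
structure GradedExpansion {α : Type*} (l : Filter α) (δ : α → ℝ) (N : ℕ) (f : α → ℝ)
    (φ : α → PowerSeries ℝ) : Prop where
  coeff_isBigO : ∀ k, (fun x => PowerSeries.coeff k (φ x)) =O[l] fun x => δ x ^ k
  sub_isBigO : (fun x => f x - ∑ k ∈ Finset.range N, PowerSeries.coeff k (φ x))
    =O[l] fun x => δ x ^ N

namespace GradedExpansion

variable {α : Type*} {l : Filter α} {δ : α → ℝ} {N : ℕ} {f g : α → ℝ}
  {φ ψ : α → PowerSeries ℝ}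

theorem pow_isBigO_pow (hδ : Tendsto δ l (nhds 0)) {m n : ℕ} (h : m ≤ n) :
    (fun x => δ x ^ n) =O[l] fun x => δ x ^ m := by
  obtain ⟨k, rfl⟩ := Nat.exists_eq_add_of_le h
  simpa [pow_add] using (isBigO_refl (fun x => δ x ^ m) l).mul ((hδ.pow k).isBigO_one ℝ)

theorem const (c : ℝ) : GradedExpansion l δ (N + 1) (fun _ => c) (fun _ => PowerSeries.C c) := by
  constructor
  · intro k
    rcases k with _ | k
    · simpa using isBigO_const_const c (one_ne_zero (α := ℝ)) l
    · simpa [PowerSeries.coeff_C] using isBigO_zero (E' := ℝ) (fun x => δ x ^ _) l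
  · simpa [PowerSeries.coeff_C] using isBigO_zero (E' := ℝ) (fun x => δ x ^ _) l

/-- A function that is `O(δ ^ m)` is its own term of degree `m`. -/
theorem homogeneous {m : ℕ} (hm : m < N) (hf : f =O[l] fun x => δ x ^ m) :
    GradedExpansion l δ N f (fun x => PowerSeries.monomial m (f x)) := by
  constructor
  · intro k
    simp only [PowerSeries.coeff_monomial]
    split_ifs with h
    · rwa [h]
    · exact isBigO_zero _ _
  · simpa [PowerSeries.coeff_monomial, hm] using
      isBigO_zero (E' := ℝ) (fun x => δ x ^ N) l

theorem add (hf : GradedExpansion l δ N f φ) (hg : GradedExpansion l δ N g ψ) :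
    GradedExpansion l δ N (fun x => f x + g x) (fun x => φ x + ψ x) := by
  constructor
  · intro k
    simpa using (hf.1 k).add (hg.1 k)
  · refine (hf.2.add hg.2).congr_left fun x => ?_
    simp [Finset.sum_add_distrib]; ring

theorem sub (hf : GradedExpansion l δ N f φ) (hg : GradedExpansion l δ N g ψ) :
    GradedExpansion l δ N (fun x => f x - g x) (fun x => φ x - ψ x) := by
  constructor
  · intro k
    simpa using (hf.1 k).sub (hg.1 k)
  · refine (hf.2.sub hg.2).congr_left fun x => ?_
    simp [Finset.sum_sub_distrib]; ring

/-- Changing a function by `O(δ ^ N)` does not affect its expansion. -/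
theorem congr_isBigO (hf : GradedExpansion l δ N f φ)
    (h : (fun x => g x - f x) =O[l] fun x => δ x ^ N) : GradedExpansion l δ N g φ :=
  ⟨hf.1, (h.add hf.2).congr_left fun x => by ring⟩

theorem sum_mul_sum_sub (N : ℕ) (a b : ℕ → ℝ) :
    (∑ i ∈ Finset.range N, a i) * (∑ j ∈ Finset.range N, b j)
      - ∑ k ∈ Finset.range N, ∑ p ∈ Finset.HasAntidiagonal.antidiagonal k, a p.1 * b p.2
      = ∑ p ∈ (Finset.range N ×ˢ Finset.range N) with N ≤ p.1 + p.2, a p.1 * b p.2 := by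
  rw [Finset.sum_mul_sum, ← Finset.sum_product', sub_eq_iff_eq_add,
    ← Finset.sum_filter_add_sum_filter_not (Finset.range N ×ˢ Finset.range N)
      (fun p => N ≤ p.1 + p.2)]
  congr 1
  rw [← Finset.sum_fiberwise_of_maps_to (t := Finset.range N) (g := fun p => p.1 + p.2)]
  · refine Finset.sum_congr rfl fun k hk => Finset.sum_congr ?_ fun _ _ => rfl
    ext p
    simp only [Finset.mem_filter, Finset.mem_product, Finset.mem_range,
      Finset.HasAntidiagonal.mem_antidiagonal]
      at hk ⊢
    omega
  · intro p hp
    simp only [Finset.mem_filter, Finset.mem_product, Finset.mem_range] at hp ⊢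
    omega

theorem isBigO_one (hδ : Tendsto δ l (nhds 0)) (hf : GradedExpansion l δ N f φ) :
    f =O[l] fun _ => (1 : ℝ) := by
  have h1 : (fun x => ∑ k ∈ Finset.range N, PowerSeries.coeff k (φ x)) =O[l] fun _ => (1 : ℝ) :=
    IsBigO.fun_sum fun k _ => by simpa using (hf.1 k).trans (pow_isBigO_pow hδ (Nat.zero_le k))
  have h2 := hf.2.trans (pow_isBigO_pow hδ (Nat.zero_le N))
  simpa using h2.add (h1.congr_right fun x => (pow_zero (δ x)).symm)

theorem mul (hδ : Tendsto δ l (nhds 0)) (hf : GradedExpansion l δ N f φ)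
    (hg : GradedExpansion l δ N g ψ) :
    GradedExpansion l δ N (fun x => f x * g x) (fun x => φ x * ψ x) := by
  constructor
  · intro k
    simp only [PowerSeries.coeff_mul]
    refine IsBigO.fun_sum fun p hp => ?_
    rw [← Finset.HasAntidiagonal.mem_antidiagonal.1 hp]
    simpa [pow_add] using (hf.1 p.1).mul (hg.1 p.2)
  · have hφ : (fun x => ∑ k ∈ Finset.range N, PowerSeries.coeff k (φ x)) =O[l]
        fun _ => (1 : ℝ) :=
      IsBigO.fun_sum fun k _ => by
        simpa using (hf.1 k).trans (pow_isBigO_pow hδ (Nat.zero_le k))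
    have h1 := hφ.mul hg.2
    have h2 := hf.2.mul (hg.isBigO_one hδ)
    have h3 : (fun x => ∑ p ∈ (Finset.range N ×ˢ Finset.range N) with N ≤ p.1 + p.2,
        PowerSeries.coeff p.1 (φ x) * PowerSeries.coeff p.2 (ψ x)) =O[l] fun x => δ x ^ N := by
      refine IsBigO.fun_sum fun p hp => ?_
      refine (((hf.1 p.1).mul (hg.1 p.2)).congr_right fun x => (pow_add _ _ _).symm).trans ?_
      exact pow_isBigO_pow hδ (Finset.mem_filter.1 hp).2
    simp only [one_mul, mul_one] at h1 h2
    refine ((h1.add h2).add h3).congr_left fun x => ?_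
    rw [← sum_mul_sum_sub N (fun k => PowerSeries.coeff k (φ x)) fun k => PowerSeries.coeff k (ψ x)]
    simp only [PowerSeries.coeff_mul]
    ring

theorem pow (hδ : Tendsto δ l (nhds 0)) (hf : GradedExpansion l δ (N + 1) f φ) (n : ℕ) :
    GradedExpansion l δ (N + 1) (fun x => f x ^ n) (fun x => φ x ^ n) := by
  induction n with
  | zero => simpa using const (l := l) (δ := δ) (N := N) 1
  | succ n ih => simpa only [pow_succ] using ih.mul hδ hf

theorem const_mul (hδ : Tendsto δ l (nhds 0)) (c : ℝ) (hf : GradedExpansion l δ (N + 1) f φ) :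
    GradedExpansion l δ (N + 1) (fun x => c * f x) (fun x => PowerSeries.C c * φ x) :=
  (const c).mul hδ hf

theorem sum {ι : Type*} (s : Finset ι) {F : ι → α → ℝ} {Φ : ι → α → PowerSeries ℝ}
    (h : ∀ i ∈ s, GradedExpansion l δ (N + 1) (F i) (Φ i)) :
    GradedExpansion l δ (N + 1) (fun x => ∑ i ∈ s, F i x) (fun x => ∑ i ∈ s, Φ i x) := by
  classical
  induction s using Finset.induction_on with
  | empty => simpa using const (l := l) (δ := δ) (N := N) 0
  | insert a s ha ih =>
    simp only [Finset.sum_insert ha]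
    exact (h a (Finset.mem_insert_self a s)).add
      (ih fun i hi => h i (Finset.mem_insert_of_mem hi))

/-- If the terms of degree less than `m` vanish, the function is `O(δ ^ m)`. -/
theorem isBigO_pow (hδ : Tendsto δ l (nhds 0)) (hf : GradedExpansion l δ N f φ) {m : ℕ}
    (hm : m ≤ N) (h : ∀ x, ∀ k < m, PowerSeries.coeff k (φ x) = 0) :
    f =O[l] fun x => δ x ^ m := by
  have h1 : (fun x => ∑ k ∈ Finset.range N, PowerSeries.coeff k (φ x)) =O[l]
      fun x => δ x ^ m := by
    refine IsBigO.fun_sum fun k _ => ?_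
    rcases lt_or_ge k m with hk | hk
    · simpa only [h _ k hk] using isBigO_zero (E' := ℝ) (fun x => δ x ^ m) l
    · exact (hf.1 k).trans (pow_isBigO_pow hδ hk)
  exact ((hf.2.trans (pow_isBigO_pow hδ hm)).add h1).congr_left fun x => by ring

/-- A function whose expansion has no term of degree zero is `O(δ)`. -/
theorem isBigO_of_coeff_zero (hδ : Tendsto δ l (nhds 0)) (hf : GradedExpansion l δ (N + 1) f φ)
    (h0 : ∀ x, PowerSeries.coeff 0 (φ x) = 0) : f =O[l] δ := by
  simpa using hf.isBigO_pow hδ (Nat.le_add_left 1 N) fun x k hk => by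
    rw [Nat.lt_one_iff.1 hk, h0]

/-- The logarithm of `1 + f` is expanded by the Mercator series. -/
theorem log_one_add (hδ : Tendsto δ l (nhds 0)) (hf : GradedExpansion l δ (N + 1) f φ)
    (h0 : ∀ x, PowerSeries.coeff 0 (φ x) = 0) :
    GradedExpansion l δ (N + 1) (fun x => Real.log (1 + f x))
      (fun x => PowerSeries.mercator N (φ x)) := by
  have hfδ := hf.isBigO_of_coeff_zero hδ h0
  have hf0 : Tendsto f l (nhds 0) := hfδ.trans_tendsto hδ
  have hs := sum (Finset.range N) fun j _ =>
    (hf.pow hδ (j + 1)).const_mul hδ ((-1) ^ j / (j + 1 : ℝ))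
  refine hs.congr_isBigO (IsBigO.trans ?_ (hfδ.pow (N + 1)))
  refine IsBigO.of_bound 2 ?_
  filter_upwards [hf0.eventually (Metric.ball_mem_nhds 0 (by norm_num : (0 : ℝ) < 1 / 2))]
    with x hx
  have hx' : |f x| < 1 / 2 := by simpa [Real.dist_eq] using hx
  have h1 := Real.abs_log_sub_add_sum_range_le (x := -f x) (by rw [abs_neg]; linarith) N
  rw [sub_neg_eq_add, abs_neg] at h1
  have h2 : Real.log (1 + f x) - ∑ j ∈ Finset.range N, (-1) ^ j / (j + 1 : ℝ) * f x ^ (j + 1)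
      = (∑ i ∈ Finset.range N, (-f x) ^ (i + 1) / (i + 1 : ℝ)) + Real.log (1 + f x) := by
    rw [sub_eq_neg_add, ← Finset.sum_neg_distrib]
    congr 1
    refine Finset.sum_congr rfl fun i _ => ?_
    rw [neg_pow (f x), pow_succ (-1 : ℝ)]
    ring
  rw [h2, Real.norm_eq_abs, Real.norm_eq_abs, abs_pow]
  refine h1.trans ?_
  rw [div_le_iff₀ (by linarith)]
  nlinarith [pow_nonneg (abs_nonneg (f x)) (N + 1)]

end GradedExpansion

/-! ### Low coefficients of products and logarithms of power series -/

namespace PowerSeries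

theorem coeff_mul_zero (φ ψ : PowerSeries ℝ) : coeff 0 (φ * ψ) = coeff 0 φ * coeff 0 ψ := by
  simp [coeff_mul]

theorem coeff_mul_one (φ ψ : PowerSeries ℝ) :
    coeff 1 (φ * ψ) = coeff 0 φ * coeff 1 ψ + coeff 1 φ * coeff 0 ψ := by
  simp [coeff_mul, Finset.Nat.antidiagonal_succ]

theorem coeff_mul_two (φ ψ : PowerSeries ℝ) :
    coeff 2 (φ * ψ) = coeff 0 φ * coeff 2 ψ + coeff 1 φ * coeff 1 ψ + coeff 2 φ * coeff 0 ψ := by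
  simp [coeff_mul, Finset.Nat.antidiagonal_succ]; ring

theorem coeff_mul_three (φ ψ : PowerSeries ℝ) :
    coeff 3 (φ * ψ) = coeff 0 φ * coeff 3 ψ + coeff 1 φ * coeff 2 ψ + coeff 2 φ * coeff 1 ψ
      + coeff 3 φ * coeff 0 ψ := by
  simp [coeff_mul, Finset.Nat.antidiagonal_succ]; ring

theorem coeff_mul_four (φ ψ : PowerSeries ℝ) :
    coeff 4 (φ * ψ) = coeff 0 φ * coeff 4 ψ + coeff 1 φ * coeff 3 ψ + coeff 2 φ * coeff 2 ψ
      + coeff 3 φ * coeff 1 ψ + coeff 4 φ * coeff 0 ψ := by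
  simp [coeff_mul, Finset.Nat.antidiagonal_succ]; ring

theorem coeff_mul_five (φ ψ : PowerSeries ℝ) :
    coeff 5 (φ * ψ) = coeff 0 φ * coeff 5 ψ + coeff 1 φ * coeff 4 ψ + coeff 2 φ * coeff 3 ψ
      + coeff 3 φ * coeff 2 ψ + coeff 4 φ * coeff 1 ψ + coeff 5 φ * coeff 0 ψ := by
  simp [coeff_mul, Finset.Nat.antidiagonal_succ]; ring

theorem coeff_pow_eq_zero {φ : PowerSeries ℝ} (h0 : coeff 0 φ = 0) {k j : ℕ} (h : k < j) :
    coeff k (φ ^ j) = 0 := by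
  have h1 : X ∣ φ := X_dvd_iff.2 (by simpa using h0)
  exact X_pow_dvd_iff.1 (pow_dvd_pow_of_dvd h1 j) k h

theorem coeff_mercator {φ : PowerSeries ℝ} (h0 : coeff 0 φ = 0) (n : ℕ) :
    coeff 0 (mercator (n + 4) φ) = 0 ∧
    coeff 1 (mercator (n + 4) φ) = coeff 1 φ ∧
    coeff 2 (mercator (n + 4) φ) = coeff 2 φ - coeff 1 φ ^ 2 / 2 ∧
    coeff 3 (mercator (n + 4) φ) = coeff 3 φ - coeff 1 φ * coeff 2 φ + coeff 1 φ ^ 3 / 3 ∧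
    coeff 4 (mercator (n + 4) φ) = coeff 4 φ - coeff 1 φ * coeff 3 φ - coeff 2 φ ^ 2 / 2
      + coeff 1 φ ^ 2 * coeff 2 φ - coeff 1 φ ^ 4 / 4 := by
  have key : ∀ k < 5, coeff k (mercator (n + 4) φ) = coeff k φ - 1 / 2 * coeff k (φ * φ)
      + 1 / 3 * coeff k (φ * φ * φ) - 1 / 4 * coeff k (φ * φ * (φ * φ)) := by
    intro k hk
    have h1 : ∀ j, coeff k (φ ^ (4 + j + 1)) = 0 := fun j => coeff_pow_eq_zero h0 (by omega)
    have h2 : φ ^ 2 = φ * φ := by ring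
    have h3 : φ ^ 3 = φ * φ * φ := by ring
    have h4 : φ ^ 4 = φ * φ * (φ * φ) := by ring
    rw [mercator, add_comm n 4, Finset.sum_range_add, map_add, map_sum, map_sum,
      Finset.sum_eq_zero (s := Finset.range n) fun j _ => by rw [coeff_C_mul, h1, mul_zero]]
    simp only [Finset.sum_range_succ, Finset.sum_range_zero, coeff_C_mul, zero_add, h2, h3, h4,
      Nat.reduceAdd, pow_one]
    norm_num
    ring
  refine ⟨?_, ?_, ?_, ?_, ?_⟩ <;> rw [key _ (by norm_num)] <;>
    simp only [coeff_mul_zero, coeff_mul_one, coeff_mul_two, coeff_mul_three, coeff_mul_four, h0,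
      zero_mul, mul_zero, zero_add, add_zero, sub_zero] <;> ring

end PowerSeries

/-! ### One step of the iteration -/

/-- The terms of degree less than six in the defect of `isBigO_stepDefect`, multiplied by `y * S`,
vanish. This fixes the coefficients `3/5`, `79/350`, `87/875`, `91543/1347500`. -/
theorem coeff_stepDefect_eq_zero (y : ℝ) (Y φ : PowerSeries ℝ) (hY0 : Y.coeff 0 = 0)
    (hY1 : Y.coeff 1 = y) (hY2 : Y.coeff 2 = 0) (hY3 : Y.coeff 3 = 0) (hY4 : Y.coeff 4 = 0)
    (hY5 : Y.coeff 5 = 0) (hφ0 : φ.coeff 0 = 0) (hφ1 : φ.coeff 1 = -1 / 3 * y)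
    (hφ2 : φ.coeff 2 = 2 / 45 * y ^ 2) (hφ3 : φ.coeff 3 = -1 / 315 * y ^ 3)
    (hφ4 : φ.coeff 4 = 2 / 14175 * y ^ 4) (hφ5 : φ.coeff 5 = -2 / 467775 * y ^ 5)
    (k : ℕ) (hk : k < 6) :
    PowerSeries.coeff k (PowerSeries.C (-3) * φ - Y * (PowerSeries.C 1 + φ)
      + PowerSeries.C (3 / 5) * (Y * ((PowerSeries.C 1 + φ) * PowerSeries.mercator 5 φ))
      + PowerSeries.C (79 / 1050) * (Y * (Y * ((PowerSeries.C 1 + φ) * φ)))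
      + PowerSeries.C (29 / 2625)
        * (Y * (Y * (Y * ((PowerSeries.C 1 + φ) * (PowerSeries.C 2 * φ + φ * φ)))))
      + PowerSeries.C (91543 / 36382500) * (Y * (Y * (Y * (Y * ((PowerSeries.C 1 + φ)
        * (PowerSeries.C 3 * φ + PowerSeries.C 3 * (φ * φ) + φ * (φ * φ)))))))) = 0 := by
  obtain ⟨hL0, hL1, hL2, hL3, hL4⟩ := PowerSeries.coeff_mercator hφ0 1
  simp only [hφ1, hφ2, hφ3, hφ4, Nat.reduceAdd] at hL0 hL1 hL2 hL3 hL4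
  interval_cases k <;>
    simp only [PowerSeries.coeff_mul_zero, PowerSeries.coeff_mul_one, PowerSeries.coeff_mul_two,
      PowerSeries.coeff_mul_three, PowerSeries.coeff_mul_four, PowerSeries.coeff_mul_five,
      map_add, map_sub, PowerSeries.coeff_C_mul, PowerSeries.coeff_C, hφ0, hφ1, hφ2, hφ3, hφ4,
      hφ5, hY0, hY1, hY2, hY3, hY4, hY5, hL0, hL1, hL2, hL3, hL4, zero_mul, mul_zero, zero_add,
      add_zero, sub_zero, one_mul, if_true, reduceIte, OfNat.ofNat_ne_zero, one_ne_zero] <;> ring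

/-- If `1 - 2yS = ∑ (-4y)ⁿ / (2n)!`, then `S` has the Taylor expansion of `(sin x / x)²` in
`y = x²`. For `y = -x²` the same series is that of `(sinh x / x)²`. -/
theorem abs_sub_taylor_le {y S : ℝ} (hy0 : y ≠ 0) (hy : |y| ≤ 1 / 8)
    (hS : HasSum (fun n : ℕ => (-4 * y) ^ n / (2 * n).factorial) (1 - 2 * y * S)) :
    |S - 1 - (-1 / 3 * y + 2 / 45 * y ^ 2 + -1 / 315 * y ^ 3 + 2 / 14175 * y ^ 4
      + -2 / 467775 * y ^ 5)| ≤ 4 ^ 7 * |y| ^ 6 := by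
  have hw : |(-4 * y)| ≤ 1 / 2 := by rw [abs_mul]; norm_num; linarith
  have h1 := (hasSum_nat_add_iff' 7).2 hS
  have hg : HasSum (fun n : ℕ => |(-4 * y)| ^ (n + 7)) (|(-4 * y)| ^ 7 * (1 - |(-4 * y)|)⁻¹) := by
    have := (hasSum_geometric_of_lt_one (abs_nonneg (-4 * y)) (by linarith)).mul_left
      (|(-4 * y)| ^ 7)
    simpa only [pow_add, mul_comm] using this
  have h2 : |1 - 2 * y * S - ∑ i ∈ Finset.range 7, (-4 * y) ^ i / ((2 * i).factorial : ℝ)|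
      ≤ |(-4 * y)| ^ 7 * (1 - |(-4 * y)|)⁻¹ := by
    have := tsum_of_norm_bounded hg (f := fun n : ℕ =>
      (-4 * y) ^ (n + 7) / ((2 * (n + 7)).factorial : ℝ)) fun n => by
        rw [Real.norm_eq_abs, abs_div, abs_pow, Nat.abs_cast]
        exact div_le_self (by positivity) (by exact_mod_cast Nat.factorial_pos _)
    rwa [h1.tsum_eq, Real.norm_eq_abs] at this
  have h3 : |(-4 * y)| ^ 7 * (1 - |(-4 * y)|)⁻¹ ≤ 2 * (4 ^ 7 * |y| ^ 7) := by
    have h4 : (1 - |(-4 * y)|)⁻¹ ≤ 2 := by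
      rw [inv_le_comm₀ (by linarith) (by norm_num)]; linarith
    have h5 : |(-4 * y)| ^ 7 = 4 ^ 7 * |y| ^ 7 := by rw [abs_mul, mul_pow]; norm_num
    rw [h5]
    nlinarith [pow_nonneg (abs_nonneg y) 7]
  have h6 : 1 - 2 * y * S - ∑ i ∈ Finset.range 7, (-4 * y) ^ i / ((2 * i).factorial : ℝ)
      = -2 * y * (S - 1 - (-1 / 3 * y + 2 / 45 * y ^ 2 + -1 / 315 * y ^ 3 + 2 / 14175 * y ^ 4
      + -2 / 467775 * y ^ 5)) := by
    simp only [Finset.sum_range_succ, Finset.sum_range_zero, Nat.factorial]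
    norm_num
    ring
  rw [h6, abs_mul, abs_mul] at h2
  have hpos : 0 < |y| := abs_pos.2 hy0
  refine le_of_mul_le_mul_left ?_ hpos
  norm_num at h2 h3 ⊢
  nlinarith

/-- The step `3 / y ↦ 3 / (y * S)`, with `S` the series of `(sin x / x) ^ 2` in `y = x ^ 2`,
increases `z - 3/5 log |z| + 79/350 z⁻¹ + 87/875 z⁻² + 91543/1347500 z⁻³` by `1 + O(y ^ 5)`. Stated
for `y` of either sign, it serves `sin` and `sinh` at once. -/
theorem isBigO_stepDefect {α : Type*} {l : Filter α} {y S : α → ℝ} (hy : Tendsto y l (nhds 0))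
    (hy0 : ∀ᶠ x in l, y x ≠ 0)
    (hS : ∀ᶠ x in l, HasSum (fun n : ℕ => (-4 * y x) ^ n / (2 * n).factorial)
      (1 - 2 * y x * S x)) :
    Tendsto S l (nhds 1) ∧ Tendsto (fun x => (1 - S x) / y x) l (nhds (1 / 3)) ∧
    (fun x => 3 / (y x * S x) - 3 / y x - 1 + 3 / 5 * Real.log (S x)
      + 79 / 350 * (y x / 3 * (S x - 1)) + 87 / 875 * ((y x / 3) ^ 2 * (S x ^ 2 - 1))
      + 91543 / 1347500 * ((y x / 3) ^ 3 * (S x ^ 3 - 1))) =O[l] fun x => y x ^ 5 := by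
  have hrem : (fun x => S x - 1 - (-1 / 3 * y x + 2 / 45 * y x ^ 2 + -1 / 315 * y x ^ 3
      + 2 / 14175 * y x ^ 4 + -2 / 467775 * y x ^ 5)) =O[l] fun x => y x ^ 6 := by
    refine IsBigO.of_bound (4 ^ 7) ?_
    filter_upwards [hy0, hS, hy.eventually (Metric.ball_mem_nhds 0 (by norm_num : (0 : ℝ) < 1 / 8))]
      with x h0 hx hs
    have := abs_sub_taylor_le h0 (by simpa [Real.dist_eq] using hs.le) hx
    simpa [abs_pow] using this
  have hY : GradedExpansion l y 6 y (fun x => PowerSeries.monomial 1 (y x)) :=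
    GradedExpansion.homogeneous (by norm_num) (by simpa using isBigO_refl y l)
  have hmon : ∀ (c : ℝ) (m : ℕ), m < 6 → GradedExpansion l y 6 (fun x => c * y x ^ m)
      (fun x => PowerSeries.monomial m (c * y x ^ m)) := fun c m hm =>
    GradedExpansion.homogeneous hm (isBigO_const_mul_self c _ l)
  have hg : GradedExpansion l y 6 (fun x => S x - 1) _ :=
    (((((hmon (-1 / 3) 1 (by norm_num)).add (hmon (2 / 45) 2 (by norm_num))).add
      (hmon (-1 / 315) 3 (by norm_num))).add (hmon (2 / 14175) 4 (by norm_num))).add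
      (hmon (-2 / 467775) 5 (by norm_num))).congr_isBigO (by simpa using hrem)
  set Y : α → PowerSeries ℝ := fun x => PowerSeries.monomial 1 (y x)
  set φ : α → PowerSeries ℝ := fun x => PowerSeries.monomial 1 (-1 / 3 * y x ^ 1)
    + PowerSeries.monomial 2 (2 / 45 * y x ^ 2) + PowerSeries.monomial 3 (-1 / 315 * y x ^ 3)
    + PowerSeries.monomial 4 (2 / 14175 * y x ^ 4)
    + PowerSeries.monomial 5 (-2 / 467775 * y x ^ 5)
  have hφ0 : ∀ x, (φ x).coeff 0 = 0 := fun x => by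
    simp [φ, PowerSeries.coeff_monomial, -PowerSeries.coeff_zero_eq_constantCoeff]
  have hL := hg.log_one_add hy hφ0
  have h1 : GradedExpansion l y 6 (fun x => 1 + (S x - 1)) _ := (GradedExpansion.const 1).add hg
  have hgg := hg.mul hy hg
  have hG := ((((((hg.const_mul hy (-3)).sub (hY.mul hy h1)).add
    ((hY.mul hy (h1.mul hy hL)).const_mul hy (3 / 5))).add
    ((hY.mul hy (hY.mul hy (h1.mul hy hg))).const_mul hy (79 / 1050))).add
    ((hY.mul hy (hY.mul hy (hY.mul hy (h1.mul hy ((hg.const_mul hy 2).add hgg))))).const_mul hy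
      (29 / 2625))).add
    ((hY.mul hy (hY.mul hy (hY.mul hy (hY.mul hy (h1.mul hy (((hg.const_mul hy 3).add
      (hgg.const_mul hy 3)).add (hg.mul hy hgg))))))).const_mul hy (91543 / 36382500)))
  have hGO := hG.isBigO_pow hy le_rfl fun x k hk => by
    refine coeff_stepDefect_eq_zero (y x) (Y x) (φ x) ?_ ?_ ?_ ?_ ?_ ?_ ?_ ?_ ?_ ?_ ?_ ?_ k hk <;>
      simp [Y, φ, PowerSeries.coeff_monomial, -PowerSeries.coeff_zero_eq_constantCoeff]
  have hgO := hg.isBigO_of_coeff_zero hy hφ0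
  have hS1 : Tendsto S l (nhds 1) := by
    simpa using (hgO.trans_tendsto hy).add_const 1
  have hSinv : (fun x => (S x)⁻¹) =O[l] fun _ => (1 : ℝ) :=
    (hS1.inv₀ one_ne_zero).isBigO_one ℝ
  refine ⟨hS1, ?_, ?_⟩
  · have h2 := (hrem.mul (isBigO_refl (fun x => (y x)⁻¹) l)).congr'
      (f₂ := fun x => (S x - 1 - (-1 / 3 * y x + 2 / 45 * y x ^ 2 + -1 / 315 * y x ^ 3
        + 2 / 14175 * y x ^ 4 + -2 / 467775 * y x ^ 5)) * (y x)⁻¹) (g₂ := fun x => y x ^ 5)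
      (Eventually.of_forall fun x => rfl)
      (hy0.mono fun x hx => by field_simp)
    have h3 := h2.trans_tendsto (by simpa using hy.pow 5)
    have h4 : Tendsto (fun x => 1 / 3 - 2 / 45 * y x + 1 / 315 * y x ^ 2 - 2 / 14175 * y x ^ 3
        + 2 / 467775 * y x ^ 4) l (nhds (1 / 3)) := by
      have : Continuous fun z : ℝ => 1 / 3 - 2 / 45 * z + 1 / 315 * z ^ 2 - 2 / 14175 * z ^ 3
        + 2 / 467775 * z ^ 4 := by fun_prop
      simpa [Function.comp_def] using (this.tendsto 0).comp hy
    refine (by simpa using h4.sub h3 : Tendsto _ l (nhds (1 / 3 : ℝ))).congr' ?_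
    filter_upwards [hy0] with x hx
    field_simp
    ring
  · refine ((hGO.mul hSinv).mul (isBigO_refl (fun x => (y x)⁻¹) l)).congr' ?_ ?_
    · filter_upwards [hy0, hS1.eventually (lt_mem_nhds (zero_lt_one (α := ℝ)))] with x hx hs
      rw [add_sub_cancel]
      field_simp
      ring
    · filter_upwards [hy0] with x hx
      field_simp

/-! ### The asymptotic inverse of the Abel function -/

/-- The bivariate form of the expansion: with `t = 1 / n` and `u = (3/10 log n + C/2) / n`,
`√n` times the expansion is `1 + iterSeries u t`. Every monomial `u ^ i * t ^ j` with
`i + j = m` contributes to the order `n ^ (-m)`, up to powers of `log n`. -/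
noncomputable def iterSeries (u t : ℝ) : ℝ :=
  u + (3 / 2 * u ^ 2 - 3 / 5 * (u * t) + 79 / 700 * t ^ 2)
    + (5 / 2 * u ^ 3 - 12 / 5 * (u ^ 2 * t) + 647 / 700 * (u * t ^ 2) - 411 / 3500 * t ^ 3)
    + (35 / 8 * u ^ 4 - 71 / 10 * (u ^ 3 * t) + 187 / 40 * (u ^ 2 * t ^ 2)
      - 2409 / 1750 * (u * t ^ 3) + 1606257 / 10780000 * t ^ 4)

/-- The expansion of `(1 + iterSeries u t) ^ (-2) - 1` up to degree four. -/
noncomputable def invSqSeries (u t : ℝ) : ℝ :=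
  -2 * u + (6 / 5 * (u * t) - 79 / 350 * t ^ 2)
    + (6 / 5 * (u ^ 2 * t) - 41 / 35 * (u * t ^ 2) + 411 / 1750 * t ^ 3)
    + (8 / 5 * (u ^ 3 * t) - 536 / 175 * (u ^ 2 * t ^ 2) + 1437 / 875 * (u * t ^ 3)
      - 87519 / 336875 * t ^ 4)

section

variable {α : Type*} {l : Filter α} {δ u t : α → ℝ}

theorem isBigO_pow_mul_pow (hu : u =O[l] δ) (ht : t =O[l] δ) (c : ℝ) (i j : ℕ) :
    (fun x => c * (u x ^ i * t x ^ j)) =O[l] fun x => δ x ^ (i + j) := by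
  simpa only [pow_add] using ((hu.pow i).mul (ht.pow j)).const_mul_left c

/-- The expansion of `invSqSeries` along `u = O(δ)`, `t = O(δ)`. -/
theorem gradedExpansion_invSqSeries (hu : u =O[l] δ) (ht : t =O[l] δ) :
    GradedExpansion l δ 5 (fun x => invSqSeries (u x) (t x)) (fun x =>
      PowerSeries.monomial 1 (-2 * u x)
      + PowerSeries.monomial 2 (6 / 5 * (u x * t x) - 79 / 350 * t x ^ 2)
      + PowerSeries.monomial 3 (6 / 5 * (u x ^ 2 * t x) - 41 / 35 * (u x * t x ^ 2)
        + 411 / 1750 * t x ^ 3)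
      + PowerSeries.monomial 4 (8 / 5 * (u x ^ 3 * t x) - 536 / 175 * (u x ^ 2 * t x ^ 2)
        + 1437 / 875 * (u x * t x ^ 3) - 87519 / 336875 * t x ^ 4)) := by
  have m := isBigO_pow_mul_pow hu ht
  refine (((GradedExpansion.homogeneous (by norm_num) ?_).add
    (GradedExpansion.homogeneous (by norm_num) ?_)).add
    (GradedExpansion.homogeneous (by norm_num) ?_)).add
    (GradedExpansion.homogeneous (by norm_num) ?_)
  · simpa using m (-2) 1 0
  · simpa using (m (6 / 5) 1 1).sub (m (79 / 350) 0 2)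
  · simpa using ((m (6 / 5) 2 1).sub (m (41 / 35) 1 2)).add (m (411 / 1750) 0 3)
  · simpa using (((m (8 / 5) 3 1).sub (m (536 / 175) 2 2)).add (m (1437 / 875) 1 3)).sub
      (m (87519 / 336875) 0 4)

/-- The expansion of `iterSeries` along `u = O(δ)`, `t = O(δ)`. -/
theorem gradedExpansion_iterSeries (hu : u =O[l] δ) (ht : t =O[l] δ) :
    GradedExpansion l δ 5 (fun x => iterSeries (u x) (t x)) (fun x =>
      PowerSeries.monomial 1 (u x)
      + PowerSeries.monomial 2 (3 / 2 * u x ^ 2 - 3 / 5 * (u x * t x) + 79 / 700 * t x ^ 2)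
      + PowerSeries.monomial 3 (5 / 2 * u x ^ 3 - 12 / 5 * (u x ^ 2 * t x)
        + 647 / 700 * (u x * t x ^ 2) - 411 / 3500 * t x ^ 3)
      + PowerSeries.monomial 4 (35 / 8 * u x ^ 4 - 71 / 10 * (u x ^ 3 * t x)
        + 187 / 40 * (u x ^ 2 * t x ^ 2) - 2409 / 1750 * (u x * t x ^ 3)
        + 1606257 / 10780000 * t x ^ 4)) := by
  have m := isBigO_pow_mul_pow hu ht
  refine (((GradedExpansion.homogeneous (by norm_num) ?_).add
    (GradedExpansion.homogeneous (by norm_num) ?_)).add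
    (GradedExpansion.homogeneous (by norm_num) ?_)).add
    (GradedExpansion.homogeneous (by norm_num) ?_)
  · simpa using hu
  · simpa using ((m (3 / 2) 2 0).sub (m (3 / 5) 1 1)).add (m (79 / 700) 0 2)
  · simpa using (((m (5 / 2) 3 0).sub (m (12 / 5) 2 1)).add (m (647 / 700) 1 2)).sub
      (m (411 / 3500) 0 3)
  · simpa using ((((m (35 / 8) 4 0).sub (m (71 / 10) 3 1)).add (m (187 / 40) 2 2)).sub
      (m (2409 / 1750) 1 3)).add (m (1606257 / 10780000) 0 4)

theorem isBigO_iterSeries_sub (hδ : Tendsto δ l (nhds 0)) (hu : u =O[l] δ) (ht : t =O[l] δ) :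
    (fun x => iterSeries (u x) (t x) - u x) =O[l] fun x => δ x ^ 2 := by
  have hU : GradedExpansion l δ 5 u (fun x => PowerSeries.monomial 1 (u x)) :=
    GradedExpansion.homogeneous (by norm_num) (by simpa using hu)
  refine ((gradedExpansion_iterSeries hu ht).sub hU).isBigO_pow hδ (by norm_num) fun x k hk => ?_
  interval_cases k <;>
    simp [PowerSeries.coeff_monomial, -PowerSeries.coeff_zero_eq_constantCoeff]

theorem isBigO_invSqSeries (hδ : Tendsto δ l (nhds 0)) (hu : u =O[l] δ) (ht : t =O[l] δ) :
    (fun x => invSqSeries (u x) (t x)) =O[l] δ :=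
  (gradedExpansion_invSqSeries hu ht).isBigO_of_coeff_zero hδ fun x => by
    simp [PowerSeries.coeff_monomial, -PowerSeries.coeff_zero_eq_constantCoeff]

/-- `1 + invSqSeries` is the inverse square of `1 + iterSeries` up to degree four. -/
theorem isBigO_sq_mul_sub_one (hδ : Tendsto δ l (nhds 0)) (hu : u =O[l] δ) (ht : t =O[l] δ) :
    (fun x => (1 + iterSeries (u x) (t x)) * (1 + iterSeries (u x) (t x))
      * (1 + invSqSeries (u x) (t x)) - 1) =O[l] fun x => δ x ^ 5 := by
  have h1 : GradedExpansion l δ 5 (fun _ => (1 : ℝ)) _ := GradedExpansion.const 1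
  have hs := h1.add (gradedExpansion_iterSeries hu ht)
  have hv := h1.add (gradedExpansion_invSqSeries hu ht)
  refine (((hs.mul hδ hs).mul hδ hv).sub h1).isBigO_pow hδ le_rfl fun x k hk => ?_
  interval_cases k <;>
    simp only [map_sub, PowerSeries.coeff_mul_zero, PowerSeries.coeff_mul_one,
      PowerSeries.coeff_mul_two, PowerSeries.coeff_mul_three, PowerSeries.coeff_mul_four,
      map_add, PowerSeries.coeff_monomial, PowerSeries.coeff_C] <;> norm_num <;> ring

/-- The terms of degree less than five in the defect of `isBigO_abelDefect`, multiplied by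
`(1 + v) ^ 3`, vanish. -/
theorem coeff_abelDefect_eq_zero (u t : ℝ) (T φ : PowerSeries ℝ) (hT0 : T.coeff 0 = 0)
    (hT1 : T.coeff 1 = t) (hT2 : T.coeff 2 = 0) (hT3 : T.coeff 3 = 0) (hT4 : T.coeff 4 = 0)
    (hφ0 : φ.coeff 0 = 0) (hφ1 : φ.coeff 1 = -2 * u)
    (hφ2 : φ.coeff 2 = 6 / 5 * (u * t) - 79 / 350 * t ^ 2)
    (hφ3 : φ.coeff 3 = 6 / 5 * (u ^ 2 * t) - 41 / 35 * (u * t ^ 2) + 411 / 1750 * t ^ 3)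
    (hφ4 : φ.coeff 4 = 8 / 5 * (u ^ 3 * t) - 536 / 175 * (u ^ 2 * t ^ 2)
        + 1437 / 875 * (u * t ^ 3) - 87519 / 336875 * t ^ 4) (k : ℕ) (hk : k < 5) :
    PowerSeries.coeff k (((PowerSeries.C 1 + φ) * ((PowerSeries.C 1 + φ) * (PowerSeries.C 1 + φ)))
      * (φ + PowerSeries.monomial 1 (2 * u)
        + PowerSeries.C (3 / 5) * (T * PowerSeries.mercator 4 φ))
      + PowerSeries.C (79 / 350) * (T * (T * ((PowerSeries.C 1 + φ) * (PowerSeries.C 1 + φ))))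
      - PowerSeries.C (87 / 875) * (T * (T * (T * (PowerSeries.C 1 + φ))))
      + PowerSeries.C (91543 / 1347500) * (T * (T * (T * T)))) = 0 := by
  obtain ⟨hL0, hL1, hL2, hL3, hL4⟩ := PowerSeries.coeff_mercator hφ0 0
  simp only [hφ1, hφ2, hφ3, hφ4, Nat.reduceAdd] at hL0 hL1 hL2 hL3 hL4
  interval_cases k <;>
    simp only [PowerSeries.coeff_mul_zero, PowerSeries.coeff_mul_one, PowerSeries.coeff_mul_two,
      PowerSeries.coeff_mul_three, PowerSeries.coeff_mul_four,
      map_add, map_sub, PowerSeries.coeff_C_mul, PowerSeries.coeff_C, PowerSeries.coeff_monomial,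
      hφ0, hφ1, hφ2, hφ3, hφ4,
      hT0, hT1, hT2, hT3, hT4, hL0, hL1, hL2, hL3, hL4, zero_mul, mul_zero, zero_add,
      add_zero, sub_zero, one_mul, if_true, reduceIte, OfNat.ofNat_ne_zero, one_ne_zero] <;>
    norm_num <;> ring

/-- With `v = invSqSeries`, this is the identity that makes `n * (1 + v)` an approximate solution
of the Abel equation, divided by `n`. -/
theorem isBigO_abelDefect (hδ : Tendsto δ l (nhds 0)) (hu : u =O[l] δ) (ht : t =O[l] δ) :
    (fun x => invSqSeries (u x) (t x) + 2 * u x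
      + 3 / 5 * (t x * Real.log (1 + invSqSeries (u x) (t x)))
      + 79 / 350 * (t x ^ 2 / (1 + invSqSeries (u x) (t x)))
      - 87 / 875 * (t x ^ 3 / (1 + invSqSeries (u x) (t x)) ^ 2)
      + 91543 / 1347500 * (t x ^ 4 / (1 + invSqSeries (u x) (t x)) ^ 3))
      =O[l] fun x => δ x ^ 5 := by
  have h1 : GradedExpansion l δ 5 (fun _ => (1 : ℝ)) _ := GradedExpansion.const 1
  have hv := gradedExpansion_invSqSeries hu ht
  have hv0 := isBigO_invSqSeries hδ hu ht
  have hL := hv.log_one_add hδ fun x => by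
    simp [PowerSeries.coeff_monomial, -PowerSeries.coeff_zero_eq_constantCoeff]
  have hT : GradedExpansion l δ 5 t (fun x => PowerSeries.monomial 1 (t x)) :=
    GradedExpansion.homogeneous (by norm_num) (by simpa using ht)
  have hU : GradedExpansion l δ 5 (fun x => 2 * u x) (fun x => PowerSeries.monomial 1 (2 * u x)) :=
    GradedExpansion.homogeneous (by norm_num) (by simpa using hu.const_mul_left 2)
  have hq := h1.add hv
  have hqq := hq.mul hδ hq
  have hG := (((((hq.mul hδ hqq).mul hδ
    ((hv.add hU).add ((hT.mul hδ hL).const_mul hδ (3 / 5)))).add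
    ((hT.mul hδ (hT.mul hδ hqq)).const_mul hδ (79 / 350))).sub
    ((hT.mul hδ (hT.mul hδ (hT.mul hδ hq))).const_mul hδ (87 / 875))).add
    ((hT.mul hδ (hT.mul hδ (hT.mul hδ hT))).const_mul hδ
      (91543 / 1347500)))
  have hGO := hG.isBigO_pow hδ le_rfl fun x k hk => by
    refine coeff_abelDefect_eq_zero (u x) (t x) _ _ ?_ ?_ ?_ ?_ ?_ ?_ ?_ ?_ ?_ ?_ k hk <;>
      simp [PowerSeries.coeff_monomial, -PowerSeries.coeff_zero_eq_constantCoeff]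
  have hq1 : Tendsto (fun x => 1 + invSqSeries (u x) (t x)) l (nhds 1) := by
    simpa using (hv0.trans_tendsto hδ).const_add 1
  have hqinv : (fun x => ((1 + invSqSeries (u x) (t x)) ^ 3)⁻¹) =O[l] fun _ => (1 : ℝ) :=
    ((hq1.pow 3).inv₀ (by norm_num)).isBigO_one ℝ
  refine (hGO.mul hqinv).congr' ?_ (Eventually.of_forall fun x => by simp)
  filter_upwards [hq1.eventually (lt_mem_nhds (zero_lt_one (α := ℝ)))] with x hx
  field_simp

end

/-! ### Sequences with nearly constant increments -/

/-- Increments of size `O(n⁻⁵)` force convergence with error `o(n⁻³)`. -/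
theorem exists_isLittleO_of_increment {b : ℕ → ℝ}
    (hb : (fun n => b (n + 1) - b n) =O[atTop] fun n : ℕ => ((n : ℝ) ^ 5)⁻¹) :
    ∃ K : ℝ, (fun n => b n - K) =o[atTop] fun n : ℕ => ((n : ℝ) ^ 3)⁻¹ := by
  have hs : Summable fun n => b (n + 1) - b n :=
    summable_of_isBigO_nat (Real.summable_nat_pow_inv.2 (by norm_num)) hb
  -- the weight `n ^ 3` is absorbed in the tail of this series, since `n ≤ k + n`
  have hs3 : Summable fun n : ℕ => (n : ℝ) ^ 3 * |b (n + 1) - b n| := by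
    refine summable_of_isBigO_nat (Real.summable_nat_pow_inv.2 (by norm_num : 1 < 2)) ?_
    refine ((isBigO_refl (fun n : ℕ => (n : ℝ) ^ 3) atTop).mul hb.abs_left).congr'
      EventuallyEq.rfl ?_
    filter_upwards [eventually_ge_atTop 1] with n hn
    have : (n : ℝ) ≠ 0 := by positivity
    field_simp
  refine ⟨b 0 + ∑' n, (b (n + 1) - b n), ?_⟩
  have htail : ∀ n, b n - (b 0 + ∑' n, (b (n + 1) - b n))
      = -∑' k, (b (k + n + 1) - b (k + n)) := fun n => by
    have h1 := hs.sum_add_tsum_nat_add n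
    rw [Finset.sum_range_sub] at h1
    rw [← h1]; ring
  have h0 := tendsto_sum_nat_add fun n : ℕ => (n : ℝ) ^ 3 * |b (n + 1) - b n|
  refine (isLittleO_iff_tendsto' ?_).2 (squeeze_zero_norm' ?_ h0)
  · filter_upwards [eventually_ge_atTop 1] with n hn h
    exact absurd h (by positivity)
  · filter_upwards [eventually_ge_atTop 1] with n hn
    have hs3n : Summable fun k : ℕ => ((k + n : ℕ) : ℝ) ^ 3 * |b (k + n + 1) - b (k + n)| :=
      (summable_nat_add_iff n).2 hs3
    rw [htail, div_inv_eq_mul, norm_mul, norm_neg, mul_comm, ← norm_mul, ← tsum_mul_left]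
    refine tsum_of_norm_bounded hs3n.hasSum fun k => ?_
    rw [norm_mul, norm_pow, Real.norm_natCast, Real.norm_eq_abs]
    gcongr
    exact Nat.le_add_left n k

theorem tendsto_div_of_tendsto_increment {w : ℕ → ℝ}
    (hw : Tendsto (fun n => w (n + 1) - w n) atTop (nhds 1)) :
    Tendsto (fun n : ℕ => w n / n) atTop (nhds 1) := by
  have h1 := hw.cesaro
  have h2 : Tendsto (fun n : ℕ => w 0 / (n : ℝ)) atTop (nhds 0) :=
    tendsto_const_div_atTop_nhds_zero_nat (w 0)
  have h3 := h1.add h2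
  rw [add_zero] at h3
  refine h3.congr fun n => ?_
  rw [Finset.sum_range_sub]
  ring

/-! ### The Abel function -/

/-- A truncated Abel function: along the iterates of `arsinh` (for `e = 1`) or `sin` (for
`e = -1`), with `w = 3 / x ^ 2`, it grows by `1 + O(w⁻⁵)` at each step. -/
noncomputable def abelFn (e w : ℝ) : ℝ :=
  w + 3 / 5 * e * Real.log w + 79 / 350 / w - 87 / 875 * e / w ^ 2 + 91543 / 1347500 / w ^ 3

theorem hasDerivAt_abelFn (e : ℝ) {w : ℝ} (hw : w ≠ 0) :
    HasDerivAt (abelFn e) (1 + 3 / 5 * e * w⁻¹ - 79 / 350 / w ^ 2 + 174 / 875 * e / w ^ 3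
      - 274629 / 1347500 / w ^ 4) w := by
  have h := ((((hasDerivAt_id w).add ((Real.hasDerivAt_log hw).const_mul (3 / 5 * e))).add
    ((hasDerivAt_id w).fun_inv hw |>.const_mul (79 / 350))).sub
    (((hasDerivAt_pow 2 w).fun_inv (by positivity)).const_mul (87 / 875 * e))).add
    (((hasDerivAt_pow 3 w).fun_inv (by positivity)).const_mul (91543 / 1347500))
  convert! h using 1
  simp
  field_simp
  ring

/-- On `[2, ∞)` the Abel function shrinks distances by a factor of at most two. -/
theorem abs_sub_le_abelFn {e : ℝ} (he : |e| ≤ 1) {v w : ℝ} (hv : 2 ≤ v) (hw : 2 ≤ w) :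
    |w - v| ≤ 2 * |abelFn e w - abelFn e v| := by
  have hd : ∀ z ∈ Set.Ici (2 : ℝ), HasDerivAt (abelFn e) _ z := fun z hz =>
    hasDerivAt_abelFn e (by have : (2 : ℝ) ≤ z := hz; positivity)
  have key : ∀ a b : ℝ, 2 ≤ a → a ≤ b → 1 / 2 * (b - a) ≤ abelFn e b - abelFn e a := by
    intro a b ha hab
    refine (convex_Ici (2 : ℝ)).mul_sub_le_image_sub_of_le_deriv
      (fun z hz => (hd z hz).continuousAt.continuousWithinAt)
      (fun z hz => (hd z (interior_subset hz)).differentiableAt.differentiableWithinAt)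
      ?_ a ha b (ha.trans hab) hab
    intro z hz
    have hz2 : (2 : ℝ) ≤ z := interior_subset hz
    have hz0 : (0 : ℝ) < z := by linarith
    rw [(hd z hz2).deriv]
    -- for `r = 1 / z ≤ 1 / 2` the terms after `1` in the derivative sum to less than `1 / 2`
    obtain ⟨r, hr⟩ : ∃ r, r = z⁻¹ := ⟨_, rfl⟩
    have hr0 : 0 ≤ r := by rw [hr]; positivity
    have hr1 : r ≤ 1 / 2 := by rw [hr, one_div]; gcongr
    have h2 : r ^ 2 ≤ 1 / 4 := by nlinarith
    have h3 : r ^ 3 ≤ 1 / 8 := by nlinarith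
    have h4 : r ^ 4 ≤ 1 / 16 := by nlinarith
    have hm : ∀ m : ℝ, 0 ≤ m → -m ≤ e * m := fun m hm => by nlinarith [abs_le.1 he]
    have h5 := hm r hr0
    have h6 := hm (r ^ 3) (by positivity)
    simp only [div_eq_mul_inv, ← inv_pow, ← hr]
    nlinarith
  rcases le_total v w with h | h
  · rw [abs_of_nonneg (by linarith)]
    linarith [key v w hv h, le_abs_self (abelFn e w - abelFn e v)]
  · rw [abs_of_nonpos (by linarith)]
    linarith [key w v hw h, neg_abs_le (abelFn e w - abelFn e v)]

/-! ### Inverting the Abel function along `n` -/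

theorem pow_log_natCast_isLittleO (k : ℕ) :
    (fun n : ℕ => Real.log n ^ k) =o[atTop] fun n : ℕ => (n : ℝ) :=
  (Real.isLittleO_pow_log_id_atTop).comp_tendsto tendsto_natCast_atTop_atTop

theorem tendsto_log_div : Tendsto (fun n : ℕ => Real.log n / n) atTop (nhds 0) := by
  simpa using (pow_log_natCast_isLittleO 1).tendsto_div_nhds_zero

theorem inv_isBigO_log_div : (fun n : ℕ => 1 / (n : ℝ)) =O[atTop] fun n : ℕ => Real.log n / n := by
  have h : Tendsto (fun n : ℕ => Real.log n) atTop atTop :=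
    Real.tendsto_log_atTop.comp tendsto_natCast_atTop_atTop
  refine IsBigO.of_bound 1 ?_
  filter_upwards [h.eventually_ge_atTop 1] with n hn
  rw [norm_div, norm_div, one_mul]
  gcongr
  simpa using hn.trans (le_abs_self _)

/-- The linear term `(3/10 log n + C/2) / n` of the expansion. -/
noncomputable def linTerm (C : ℝ) (n : ℕ) : ℝ := (3 / 10 * Real.log n + C / 2) * (1 / n)

theorem linTerm_isBigO (C : ℝ) : linTerm C =O[atTop] fun n : ℕ => Real.log n / n := by
  have h1 : (fun n : ℕ => Real.log n / n) =O[atTop] fun n : ℕ => Real.log n / n :=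
    isBigO_refl _ _
  refine ((h1.const_mul_left (3 / 10)).add (inv_isBigO_log_div.const_mul_left (C / 2))).congr_left
    fun n => ?_
  simp only [linTerm]; ring

theorem log_div_pow_isLittleO (k : ℕ) : (fun n : ℕ => (Real.log n / n) ^ (k + 1)) =o[atTop]
    fun n : ℕ => ((n : ℝ) ^ k)⁻¹ := by
  refine ((pow_log_natCast_isLittleO (k + 1)).mul_isBigO
    (isBigO_refl (fun n : ℕ => ((n : ℝ) ^ (k + 1))⁻¹) atTop)).congr' ?_ ?_
  · exact Eventually.of_forall fun n => by simp only [div_eq_mul_inv, mul_pow, inv_pow]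
  · filter_upwards [eventually_ge_atTop 1] with n hn
    have : (n : ℝ) ≠ 0 := by positivity
    field_simp
    ring

/-- The expansion of `x n / √3` with constant `C`, for `arsinh` (`e = 1`) and `sin` (`e = -1`). -/
noncomputable def signedExpansion (e C : ℝ) (n : ℕ) : ℝ :=
  (√(n : ℝ))⁻¹ * (1 + iterSeries (e * linTerm C n) (e * (1 / n)))

section

variable {e : ℝ}

theorem signed_linTerm_isBigO (e C : ℝ) :
    (fun n => e * linTerm C n) =O[atTop] fun n : ℕ => Real.log n / n :=
  (linTerm_isBigO C).const_mul_left e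

theorem signed_inv_isBigO (e : ℝ) :
    (fun n : ℕ => e * (1 / (n : ℝ))) =O[atTop] fun n : ℕ => Real.log n / n :=
  inv_isBigO_log_div.const_mul_left e

/-- The approximate solution `V` of `abelFn e V = n - e * C`. -/
noncomputable def abelInv (e C : ℝ) (n : ℕ) : ℝ :=
  n * (1 + invSqSeries (e * linTerm C n) (e * (1 / n)))

theorem tendsto_invSqSeries (e C : ℝ) : Tendsto (fun n : ℕ =>
    1 + invSqSeries (e * linTerm C n) (e * (1 / n))) atTop (nhds 1) := by
  simpa using ((isBigO_invSqSeries tendsto_log_div (signed_linTerm_isBigO e C)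
    (signed_inv_isBigO e)).trans_tendsto tendsto_log_div).const_add 1

/-- The exact difference is `n` times the defect of `isBigO_abelDefect` at `e * linTerm` and
`e / n`; the factors `e` match because `e ^ 2 = 1`, and `2 * e * linTerm C n` accounts for
`3 / 5 * e * log n + e * C`. -/
theorem abelFn_abelInv (he : e ^ 2 = 1) (C : ℝ) :
    (fun n => abelFn e (abelInv e C n) - (n - e * C)) =o[atTop] fun n : ℕ => ((n : ℝ) ^ 3)⁻¹ := by
  have hD := (isBigO_abelDefect tendsto_log_div (signed_linTerm_isBigO e C)
    (signed_inv_isBigO e)).trans_isLittleO (log_div_pow_isLittleO 4)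
  have hv := tendsto_invSqSeries e C
  refine ((isBigO_refl (fun n : ℕ => (n : ℝ)) atTop).mul_isLittleO hD).congr' ?_ ?_
  · filter_upwards [eventually_ge_atTop 1, hv.eventually (lt_mem_nhds zero_lt_one)] with n hn hv
    have hn0 : (n : ℝ) ≠ 0 := by positivity
    simp only [abelFn, abelInv]
    rw [Real.log_mul hn0 hv.ne']
    have h3 : e ^ 3 = e := by rw [pow_succ, he, one_mul]
    have h4 : e ^ 4 = 1 := by rw [show e ^ 4 = (e ^ 2) ^ 2 by ring, he, one_pow]
    generalize invSqSeries (e * linTerm C n) (e * (1 / n)) = v at hv ⊢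
    simp only [mul_pow, he, h3, h4, linTerm]
    field_simp
    ring
  · filter_upwards [eventually_ge_atTop 1] with n hn
    have hn0 : (n : ℝ) ≠ 0 := by positivity
    field_simp

/-- A sequence with the same Abel function as `abelInv`, up to `o(n⁻³)`, is itself close to it. -/
theorem sub_abelInv_isLittleO (he : e ^ 2 = 1) {C : ℝ} {w : ℕ → ℝ}
    (hw : Tendsto (fun n : ℕ => w n / n) atTop (nhds 1))
    (h : (fun n => abelFn e (w n) - (n - e * C)) =o[atTop] fun n : ℕ => ((n : ℝ) ^ 3)⁻¹) :
    (fun n => w n - abelInv e C n) =o[atTop] fun n : ℕ => ((n : ℝ) ^ 3)⁻¹ := by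
  have h1 := h.sub (abelFn_abelInv he C)
  have habs : |e| ≤ 1 := by rw [← sq_le_one_iff_abs_le_one, he]
  refine (IsBigO.of_bound 2 ?_).trans_isLittleO h1
  filter_upwards [eventually_ge_atTop 4,
    hw.eventually (lt_mem_nhds (by norm_num : (1 / 2 : ℝ) < 1)),
    (tendsto_invSqSeries e C).eventually (lt_mem_nhds (by norm_num : (1 / 2 : ℝ) < 1))]
    with n hn h2 h3
  have hn4 : (4 : ℝ) ≤ n := by exact_mod_cast hn
  rw [lt_div_iff₀ (by linarith)] at h2
  have h4 : 2 ≤ abelInv e C n := by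
    simp only [abelInv]; nlinarith
  rw [Real.norm_eq_abs, Real.norm_eq_abs, sub_sub_sub_cancel_right]
  exact abs_sub_le_abelFn habs h4 (by linarith)

/-- If `w` solves `abelFn e w = n - e * C` up to `o(n⁻³)`, then `w ^ (-1/2)` has the expansion
with constant `C`. -/
theorem isLittleO_signedExpansion (he : e ^ 2 = 1) {C : ℝ} {w : ℕ → ℝ}
    (hw : Tendsto (fun n : ℕ => w n / n) atTop (nhds 1))
    (h : (fun n => abelFn e (w n) - (n - e * C)) =o[atTop] fun n : ℕ => ((n : ℝ) ^ 3)⁻¹) :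
    (fun n => (√(w n))⁻¹ - signedExpansion e C n) =o[atTop]
      fun n : ℕ => (n : ℝ) ^ (-(9 / 2) : ℝ) := by
  have hwV := sub_abelInv_isLittleO he hw h
  have hv := tendsto_invSqSeries e C
  have hsq := (isBigO_sq_mul_sub_one tendsto_log_div (signed_linTerm_isBigO e C)
    (signed_inv_isBigO e)).trans_isLittleO (log_div_pow_isLittleO 4)
  have hs : Tendsto (fun n : ℕ => 1 + iterSeries (e * linTerm C n) (e * (1 / n))) atTop
      (nhds 1) := by
    have h1 := (isBigO_iterSeries_sub tendsto_log_div (signed_linTerm_isBigO e C)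
      (signed_inv_isBigO e)).trans_tendsto (by simpa using tendsto_log_div.pow 2)
    have h2 := (signed_linTerm_isBigO e C).trans_tendsto tendsto_log_div
    simpa using (h1.add h2).const_add 1
  have hr : Tendsto (fun n : ℕ => (√(w n / n))⁻¹) atTop (nhds 1) := by
    simpa using (hw.sqrt).inv₀ (by simp)
  have hwi : Tendsto (fun n : ℕ => (w n / n)⁻¹) atTop (nhds 1) := by
    simpa using hw.inv₀ one_ne_zero
  have hvi : Tendsto (fun n : ℕ => (1 + invSqSeries (e * linTerm C n) (e * (1 / n)))⁻¹) atTop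
      (nhds 1) := by
    simpa using hv.inv₀ one_ne_zero
  have hsumi : Tendsto (fun n : ℕ => ((√(w n / n))⁻¹
      + (1 + iterSeries (e * linTerm C n) (e * (1 / n))))⁻¹) atTop (nhds (1 + 1)⁻¹) :=
    (hr.add hs).inv₀ (by norm_num)
  -- With `V = n (1 + v)`, both summands of
  -- `(1 + s) ^ 2 - n / w = ((1 + s) ^ 2 - 1 / (1 + v)) + (n / V - n / w)` are `o(n⁻⁴)`; dividing
  -- by `(1 + s) + √(n / w)`, which tends to `2`, and by `√n` gives the claim.
  have h1 : (fun n : ℕ => (n : ℝ)⁻¹ * (w n - abelInv e C n)) =o[atTop]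
      fun n : ℕ => ((n : ℝ) ^ 4)⁻¹ := by
    refine ((isBigO_refl (fun n : ℕ => (n : ℝ)⁻¹) atTop).mul_isLittleO hwV).congr_right fun n => ?_
    rw [← mul_inv, ← pow_succ']
  have h2 := (h1.mul_isBigO ((hwi.mul hvi).isBigO_one ℝ)).add
    (hsq.mul_isBigO (hvi.isBigO_one ℝ))
  have h3 := (h2.neg_left.mul_isBigO (hsumi.isBigO_one ℝ))
  have h4 := (isBigO_refl (fun n : ℕ => (√(n : ℝ))⁻¹) atTop).mul_isLittleO h3
  refine h4.congr' ?_ ?_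
  · filter_upwards [eventually_ge_atTop 1, hw.eventually (lt_mem_nhds zero_lt_one),
      hv.eventually (lt_mem_nhds zero_lt_one), hs.eventually (lt_mem_nhds zero_lt_one)]
      with n hn hwn hvn hsn
    have hn0 : (0 : ℝ) < n := by positivity
    have hw0 : 0 < w n := by
      have := mul_pos hwn hn0
      rwa [div_mul_cancel₀ _ hn0.ne'] at this
    simp only [abelInv, signedExpansion]
    generalize invSqSeries (e * linTerm C n) (e * (1 / n)) = v at hvn ⊢
    generalize iterSeries (e * linTerm C n) (e * (1 / n)) = s at hsn ⊢
    have ha : 0 < √(w n) := Real.sqrt_pos.2 hw0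
    have hb : 0 < √(n : ℝ) := Real.sqrt_pos.2 hn0
    rw [Real.sqrt_div hw0.le]
    have ha2 : w n = √(w n) ^ 2 := (Real.sq_sqrt hw0.le).symm
    have hb2 : (n : ℝ) = √(n : ℝ) ^ 2 := (Real.sq_sqrt hn0.le).symm
    generalize √(w n) = a at *
    generalize √(n : ℝ) = b at *
    rw [ha2, hb2]
    have hd : b + a * (1 + s) ≠ 0 := by positivity
    field_simp
    ring
  · filter_upwards [eventually_ge_atTop 1] with n hn
    have hn0 : (0 : ℝ) < n := by positivity
    rw [show (-(9 / 2) : ℝ) = -(1 / 2) + -(4 : ℕ) by norm_num, Real.rpow_add hn0,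
      Real.rpow_neg hn0.le, Real.rpow_neg hn0.le, Real.rpow_natCast, Real.sqrt_eq_rpow]
    ring

/-- The constant is determined by the term of order `n ^ (-3/2)`. -/
theorem eq_of_signedExpansion_sub_isLittleO (he : e ^ 2 = 1) {C D : ℝ}
    (h : (fun n => signedExpansion e C n - signedExpansion e D n) =o[atTop]
      fun n : ℕ => (n : ℝ) ^ (-(9 / 2) : ℝ)) : C = D := by
  have hO : ∀ C, (fun n : ℕ => iterSeries (e * linTerm C n) (e * (1 / n)) - e * linTerm C n)
      =o[atTop] fun n : ℕ => (n : ℝ)⁻¹ := fun C => by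
    simpa using (isBigO_iterSeries_sub tendsto_log_div (signed_linTerm_isBigO e C)
      (signed_inv_isBigO e)).trans_isLittleO (log_div_pow_isLittleO 1)
  have h1 : (fun n : ℕ => √(n : ℝ) * (signedExpansion e C n - signedExpansion e D n))
      =o[atTop] fun n : ℕ => (n : ℝ)⁻¹ := by
    refine ((isBigO_refl (fun n : ℕ => √(n : ℝ)) atTop).mul_isLittleO h).trans_isBigO ?_
    refine IsBigO.of_bound 1 ?_
    filter_upwards [eventually_ge_atTop 1] with n hn
    have hn0 : (0 : ℝ) < n := by positivity
    have hn1 : (1 : ℝ) ≤ n := by exact_mod_cast hn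
    rw [Real.sqrt_eq_rpow, ← Real.rpow_add hn0, one_mul, ← Real.rpow_neg_one, Real.norm_eq_abs,
      Real.norm_eq_abs, abs_of_pos (by positivity), abs_of_pos (by positivity)]
    exact Real.rpow_le_rpow_of_exponent_le hn1 (by norm_num)
  have h2 := (h1.sub ((hO C).sub (hO D))).tendsto_div_nhds_zero
  have h3 : Tendsto (fun _ : ℕ => e * ((C - D) / 2)) atTop (nhds 0) := by
    refine h2.congr' ?_
    filter_upwards [eventually_ge_atTop 1] with n hn
    have hn0 : (0 : ℝ) < n := by positivity
    have hb : √(n : ℝ) ≠ 0 := (Real.sqrt_pos.2 hn0).ne'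
    simp only [signedExpansion]
    rw [← mul_sub, ← mul_assoc, mul_inv_cancel₀ hb]
    simp only [linTerm]
    field_simp
    ring
  have h4 := tendsto_nhds_unique h3 tendsto_const_nhds
  have he0 : e ≠ 0 := fun h => by simp [h] at he
  rcases mul_eq_zero.1 h4.symm with h5 | h5
  · exact absurd h5 he0
  · linarith

end

/-! ### The two iterations -/

/-- The expansion along positive `w` whose increments tend to `1` and whose Abel function grows by
`1 + O(n⁻⁵)` at each step, where `w = 3 / x ^ 2`. The step bound may use `w n ~ n`. -/
theorem existsUnique_expansion {e : ℝ} (he : e ^ 2 = 1) {x : ℕ → ℝ} (hx : ∀ n, 0 < x n)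
    (hw : Tendsto (fun n => 3 / x (n + 1) ^ 2 - 3 / x n ^ 2) atTop (nhds 1))
    (hstep : Tendsto (fun n : ℕ => 3 / x n ^ 2 / n) atTop (nhds 1) →
      (fun n => abelFn e (3 / x (n + 1) ^ 2) - abelFn e (3 / x n ^ 2) - 1) =O[atTop]
        fun n : ℕ => ((n : ℝ) ^ 5)⁻¹)
    {F : ℝ → ℕ → ℝ} (hF : ∀ C, ∀ n : ℕ, 1 ≤ n → F C n = signedExpansion e C n) :
    ∃! C : ℝ, (fun n => x n / √3 - F C n) =o[atTop] fun n : ℕ => (n : ℝ) ^ (-(9 / 2) : ℝ) := by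
  have hwn := tendsto_div_of_tendsto_increment (w := fun n => 3 / x n ^ 2) hw
  obtain ⟨K, hK⟩ := exists_isLittleO_of_increment (b := fun n => abelFn e (3 / x n ^ 2) - n)
    ((hstep hwn).congr_left fun n => by push_cast; ring)
  have hiff : ∀ C, ((fun n => x n / √3 - F C n) =o[atTop] fun n : ℕ => (n : ℝ) ^ (-(9 / 2) : ℝ)) ↔
      (fun n => x n / √3 - signedExpansion e C n) =o[atTop]
        fun n : ℕ => (n : ℝ) ^ (-(9 / 2) : ℝ) := fun C => by
    refine isLittleO_congr ?_ EventuallyEq.rfl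
    filter_upwards [eventually_ge_atTop 1] with n hn
    rw [hF C n hn]
  simp only [hiff]
  -- the Abel function is `n + K` up to `o(n⁻³)`, and `-(e * C) = K` since `e ^ 2 = 1`
  have hC : (fun n => x n / √3 - signedExpansion e (-(e * K)) n) =o[atTop]
      fun n : ℕ => (n : ℝ) ^ (-(9 / 2) : ℝ) := by
    refine (isLittleO_signedExpansion he (C := -(e * K)) hwn
      (hK.congr_left fun n => ?_)).congr_left fun n => ?_
    · linear_combination K * he
    · rw [Real.sqrt_div (by norm_num), Real.sqrt_sq (hx n).le, inv_div]
  refine ⟨-(e * K), hC, fun D hD => eq_of_signedExpansion_sub_isLittleO he ?_⟩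
  exact (hC.sub hD).congr_left fun n => by ring

/-- Iterates of a continuous `f` with `f z < z` decrease to a fixed point, which can only be `0`. -/
theorem tendsto_zero_of_iterate {f : ℝ → ℝ} (hf : Continuous f) {x : ℕ → ℝ} (hx : ∀ n, 0 < x n)
    (hstep : ∀ n, x (n + 1) = f (x n)) (hlt : ∀ z, 0 < z → f z < z) :
    Tendsto x atTop (nhds 0) := by
  have hanti : Antitone x := antitone_nat_of_succ_le fun n => by
    rw [hstep]; exact (hlt _ (hx n)).le
  have hlim := tendsto_atTop_ciInf hanti ⟨0, by rintro _ ⟨n, rfl⟩; exact (hx n).le⟩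
  have h0 : 0 ≤ ⨅ n, x n := le_ciInf fun n => (hx n).le
  have hfix : f (⨅ n, x n) = ⨅ n, x n := by
    refine tendsto_nhds_unique ?_ (hlim.comp (tendsto_add_atTop_nat 1))
    exact ((hf.tendsto _).comp hlim).congr fun n => (hstep n).symm
  rcases h0.eq_or_lt with h | h
  · rwa [← h] at hlim
  · exact absurd hfix (hlt _ h).ne

/-- If `w n ~ n` then `(c / w n) ^ k = O(n ^ (-k))`. -/
theorem isBigO_pow_inv_of_tendsto_div {w : ℕ → ℝ}
    (hw : Tendsto (fun n : ℕ => w n / n) atTop (nhds 1)) (c : ℝ) (k : ℕ) :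
    (fun n => (c / w n) ^ k) =O[atTop] fun n : ℕ => ((n : ℝ) ^ k)⁻¹ := by
  have h1 := ((hw.inv₀ one_ne_zero).isBigO_one ℝ).mul
    (isBigO_refl (fun n : ℕ => (n : ℝ)⁻¹) atTop)
  have h2 := (h1.const_mul_left c).pow k
  refine h2.congr' ?_ (Eventually.of_forall fun n => by simp)
  filter_upwards [eventually_ge_atTop 1] with n hn
  have hn0 : (n : ℝ) ≠ 0 := by positivity
  field_simp

/-- The power series of `S = (sin x / x) ^ 2` in `y = x ^ 2`, as `1 - 2 * y * S = cos (2 * x)`. -/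
theorem hasSum_sin_sq (x S y : ℝ) (hy : y = x ^ 2) (hS : y * S = Real.sin x ^ 2) :
    HasSum (fun n : ℕ => (-4 * y) ^ n / (2 * n).factorial) (1 - 2 * y * S) := by
  have h := Real.hasSum_cos (2 * x)
  rw [Real.cos_two_mul, Real.cos_sq'] at h
  convert! h using 1
  · ext n
    rw [hy, pow_mul, ← mul_pow]
    congr 2; ring
  · rw [mul_assoc, hS]; ring

/-- The power series of `S = (sinh x / x) ^ 2` in `y = -x ^ 2`, as
`1 - 2 * y * S = cosh (2 * x)`. -/
theorem hasSum_sinh_sq (x S y : ℝ) (hy : y = -x ^ 2) (hS : y * S = -Real.sinh x ^ 2) :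
    HasSum (fun n : ℕ => (-4 * y) ^ n / (2 * n).factorial) (1 - 2 * y * S) := by
  have h := Real.hasSum_cosh (2 * x)
  rw [Real.cosh_two_mul, Real.cosh_sq] at h
  convert! h using 1
  · ext n
    rw [hy, pow_mul]
    congr 2; ring
  · rw [mul_assoc, hS]; ring

/-- For `sin` the step relation is used with `y = x n ^ 2`, so that `3 / y` becomes
`3 / x (n + 1) ^ 2`. -/
theorem existsUnique_expansion_sin {x : ℕ → ℝ} (h0 : 0 < x 0) (hpi : x 0 < Real.pi)
    (hx : ∀ n, x (n + 1) = Real.sin (x n)) {F : ℝ → ℕ → ℝ}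
    (hF : ∀ C, ∀ n : ℕ, 1 ≤ n → F C n = signedExpansion (-1) C n) :
    ∃! C : ℝ, (fun n => x n / √3 - F C n) =o[atTop] fun n : ℕ => (n : ℝ) ^ (-(9 / 2) : ℝ) := by
  have hb : ∀ n, 0 < x n ∧ x n < Real.pi := fun n => by
    induction n with
    | zero => exact ⟨h0, hpi⟩
    | succ n ih =>
      rw [hx]
      exact ⟨Real.sin_pos_of_pos_of_lt_pi ih.1 ih.2,
        (Real.sin_le_one _).trans_lt (by linarith [Real.pi_gt_three])⟩
  have hpos : ∀ n, 0 < x n := fun n => (hb n).1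
  have hlim := tendsto_zero_of_iterate Real.continuous_sin hpos hx fun z => Real.sin_lt
  obtain ⟨hS1, hSd, hO⟩ := isBigO_stepDefect (l := atTop) (y := fun n => x n ^ 2)
    (S := fun n => x (n + 1) ^ 2 / x n ^ 2) (by simpa using hlim.pow 2)
    (Eventually.of_forall fun n => (pow_pos (hpos n) 2).ne')
    (Eventually.of_forall fun n => hasSum_sin_sq (x n) _ _ rfl (by
      rw [mul_div_cancel₀ _ (pow_pos (hpos n) 2).ne', hx]))
  refine existsUnique_expansion (by norm_num) hpos ?_ ?_ hF
  · have h := (hSd.mul (hS1.inv₀ one_ne_zero)).const_mul 3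
    norm_num at h
    refine h.congr fun n => ?_
    have h1 := (hpos n).ne'
    have h2 := (hpos (n + 1)).ne'
    field_simp
  · intro hwn
    refine (hO.congr_left fun n => ?_).trans ?_
    · have h1 := (hpos n).ne'
      have h2 := (hpos (n + 1)).ne'
      simp only [abelFn]
      rw [Real.log_div (by positivity) (by positivity),
        Real.log_div (by positivity) (by positivity),
        Real.log_div (by positivity) (by positivity)]
      field_simp
      ring
    · refine (isBigO_pow_inv_of_tendsto_div hwn 3 5).congr_left fun n => ?_
      have h1 := (hpos n).ne'
      field_simp

/-- For `arsinh` the step relation is used with `y = -x (n + 1) ^ 2`: since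
`sinh (x (n + 1)) = x n`, the iteration runs backwards and `-3 / (y * S) = 3 / x n ^ 2` becomes
`-3 / y = 3 / x (n + 1) ^ 2`. -/
theorem existsUnique_expansion_arsinh {x : ℕ → ℝ} (h0 : 0 < x 0)
    (hx : ∀ n, x (n + 1) = Real.arsinh (x n)) {F : ℝ → ℕ → ℝ}
    (hF : ∀ C, ∀ n : ℕ, 1 ≤ n → F C n = signedExpansion 1 C n) :
    ∃! C : ℝ, (fun n => x n / √3 - F C n) =o[atTop] fun n : ℕ => (n : ℝ) ^ (-(9 / 2) : ℝ) := by
  have hpos : ∀ n, 0 < x n := fun n => by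
    induction n with
    | zero => exact h0
    | succ n ih => rw [hx]; exact Real.arsinh_pos_iff.2 ih
  have hlim := tendsto_zero_of_iterate Real.continuous_arsinh hpos hx fun z hz => by
    rw [← Real.sinh_lt_sinh, Real.sinh_arsinh]; exact Real.self_lt_sinh_iff.2 hz
  have hsinh : ∀ n, Real.sinh (x (n + 1)) = x n := fun n => by rw [hx, Real.sinh_arsinh]
  obtain ⟨hS1, hSd, hO⟩ := isBigO_stepDefect (l := atTop) (y := fun n => -x (n + 1) ^ 2)
    (S := fun n => x n ^ 2 / x (n + 1) ^ 2)
    (by simpa using ((hlim.comp (tendsto_add_atTop_nat 1)).pow 2).neg)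
    (Eventually.of_forall fun n => neg_ne_zero.2 (pow_pos (hpos (n + 1)) 2).ne')
    (Eventually.of_forall fun n => hasSum_sinh_sq (x (n + 1)) _ _ rfl (by
      rw [neg_mul, mul_div_cancel₀ _ (pow_pos (hpos (n + 1)) 2).ne', hsinh]))
  refine existsUnique_expansion (by norm_num) hpos ?_ ?_ hF
  · have h := (hSd.mul (hS1.inv₀ one_ne_zero)).const_mul 3
    norm_num at h
    refine h.congr fun n => ?_
    have h1 := (hpos n).ne'
    have h2 := (hpos (n + 1)).ne'
    field_simp
    ring
  · intro hwn
    have hwn1 : Tendsto (fun n : ℕ => 3 / x (n + 1) ^ 2 / n) atTop (nhds 1) := by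
      have h1 := (hwn.comp (tendsto_add_atTop_nat 1)).mul
        (tendsto_natCast_div_add_atTop (1 : ℝ) |>.inv₀ one_ne_zero)
      norm_num at h1
      refine h1.congr' ?_
      filter_upwards [eventually_ge_atTop 1] with n hn
      have hn0 : (n : ℝ) ≠ 0 := by positivity
      field_simp
    refine (hO.congr_left fun n => ?_).trans ?_
    · have h1 := (hpos n).ne'
      have h2 := (hpos (n + 1)).ne'
      simp only [abelFn]
      rw [Real.log_div (by positivity) (by positivity),
        Real.log_div (by positivity) (by positivity),
        Real.log_div (by positivity) (by positivity)]
      field_simp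
      ring
    · refine (isBigO_pow_inv_of_tendsto_div hwn1 (-3) 5).congr_left fun n => ?_
      have h1 := (hpos (n + 1)).ne'
      field_simp

/-! ### The coefficient tables -/

theorem natCast_rpow_add_half {n : ℕ} (hn : 1 ≤ n) (m : ℕ) :
    (n : ℝ) ^ ((m : ℝ) + 1 / 2) = (n : ℝ) ^ m * √(n : ℝ) := by
  have hn0 : (0 : ℝ) < n := by positivity
  rw [Real.rpow_add hn0, Real.rpow_natCast, Real.sqrt_eq_rpow]

theorem iterExpansion_arsinhCoeff (C : ℝ) (n : ℕ) (hn : 1 ≤ n) :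
    iterExpansion arsinhCoeff C n = signedExpansion 1 C n := by
  have hn0 : (0 : ℝ) < n := by positivity
  have hb : √(n : ℝ) ≠ 0 := (Real.sqrt_pos.2 hn0).ne'
  simp only [iterExpansion, natCast_rpow_add_half hn]
  simp only [Finset.sum_range_succ, Finset.sum_range_zero, arsinhCoeff, signedExpansion,
    iterSeries, linTerm]
  field_simp
  ring

theorem sinCoeff_eq {m k : ℕ} (hm : m ≤ 4) (hk : k ≤ m) (C : ℝ) :
    sinCoeff m k C = (-1) ^ m * arsinhCoeff m k C := by
  interval_cases m <;> interval_cases k <;> norm_num [sinCoeff, arsinhCoeff]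

theorem iterExpansion_sinCoeff (C : ℝ) (n : ℕ) (hn : 1 ≤ n) :
    iterExpansion sinCoeff C n = signedExpansion (-1) C n := by
  have hn0 : (0 : ℝ) < n := by positivity
  have hb : √(n : ℝ) ≠ 0 := (Real.sqrt_pos.2 hn0).ne'
  simp only [iterExpansion, natCast_rpow_add_half hn]
  simp only [Finset.sum_range_succ, Finset.sum_range_zero, sinCoeff, signedExpansion,
    iterSeries, linTerm]
  field_simp
  ring

theorem mainTheorem2 :
    -- iterates of `arsinh`: the expansion to order `n ^ (-9/2)`
    (∀ x : ℕ → ℝ, 0 < x 0 → (∀ n, x (n + 1) = Real.arsinh (x n)) →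
      ∃! C : ℝ, (fun n : ℕ => x n / √3 - iterExpansion arsinhCoeff C n)
        =o[atTop] fun n : ℕ => (n : ℝ) ^ (-(9 / 2) : ℝ)) ∧
    -- the expansion in terms of the polynomials `P₀, …, P₄` (here `λ = 3`, `τ = 2`, `b₁ = -3/5`)
    (∀ (C : ℝ) (n : ℕ), 1 ≤ n →
      √3 * iterExpansion arsinhCoeff C n =
        (3 / (n : ℝ)) ^ (1 / 2 : ℝ) *
          (1 + ∑ m ∈ Finset.Icc 1 4,
            arsinhP m (-(1 / 2) * (-(3 / 5) * Real.log n - C)) * (1 / (n : ℝ) ^ m))) ∧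
    -- iterates of `sin`
    (∀ x : ℕ → ℝ, 0 < x 0 → x 0 < Real.pi → (∀ n, x (n + 1) = Real.sin (x n)) →
      ∃! C : ℝ, (fun n : ℕ => x n / √3 - iterExpansion sinCoeff C n)
        =o[atTop] fun n : ℕ => (n : ℝ) ^ (-(9 / 2) : ℝ)) ∧
    -- the two expansions agree term by term up to sign, block `m` carrying the sign `(-1) ^ m`
    (∀ (m k : ℕ) (C : ℝ), k ≤ m → m ≤ 4 →
      sinCoeff m k C = (-1) ^ m * arsinhCoeff m k C ∧
        |sinCoeff m k C| = |arsinhCoeff m k C|) := by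
  refine ⟨fun x h0 hx => existsUnique_expansion_arsinh h0 hx iterExpansion_arsinhCoeff, ?_,
    fun x h0 hpi hx => existsUnique_expansion_sin h0 hpi hx iterExpansion_sinCoeff, ?_⟩
  · intro C n hn
    have hn0 : (0 : ℝ) < n := by positivity
    have hb : √(n : ℝ) ≠ 0 := (Real.sqrt_pos.2 hn0).ne'
    rw [iterExpansion_arsinhCoeff C n hn, ← Real.sqrt_eq_rpow, Real.sqrt_div (by norm_num),
      div_eq_mul_inv, mul_assoc, signedExpansion]
    congr 2
    rw [show Finset.Icc 1 4 = {1, 2, 3, 4} from rfl]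
    simp [iterSeries, linTerm, arsinhP]
    field_simp
    ring
  · intro m k C hk hm
    rw [sinCoeff_eq hm hk]
    refine ⟨rfl, ?_⟩
    rw [abs_mul, abs_pow, abs_neg, abs_one, one_pow, one_mul]
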